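/- Let $n\ge 1$, $s\ge 2$, and let $M^{2n+s}(f,Q,\xi_i,\eta^i,g)$ be a metric weak $f$-manifold. That is, $M$ is a smooth (Hausdorff, second countable) manifold of dimension $2n+s$ with a smooth $(1,1)$-tensor $f$ of rank $2n$, a nonsingular smooth $(1,1)$-tensor $Q$, smooth vector fields $\xi_1,\dots,\xi_s$, smooth $1$-forms $\eta^1,\dots,\eta^s$ and a Riemannian metric $g$ such that $$f^3+fQ=0,\quad f^2=-Q+\sum_i\eta^i\otimes\xi_i,\quad \eta^i(\xi_j)=\delta^i_j,\quad Q\xi_i=\xi_i,$$ the distribution $\bigcap_i\ker\eta^i$ is $f$-invariant, and $g(fX,fY)=g(X,QY)-\sum_i\eta^i(X)\eta^i(Y)$ for all vector fields $X,Y$. Put $\widetilde Q=Q-\mathrm{id}$, $\bar\xi=\sum_i\xi_i$, $\bar\eta=\sum_i\eta^i$, $\Phi(X,Y)=g(X,fY)$, and use the normalizations $2\,d\eta(X,Y)=X(\eta(Y))-Y(\eta(X))-\eta([X,Y])$, $3\,d\Phi(X,Y,Z)=X\Phi(Y,Z)+Y\Phi(Z,X)+Z\Phi(X,Y)-\Phi([X,Y],Z)-\Phi([Z,X],Y)-\Phi([Y,Z],X)$,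 $3\,(\bar\eta\wedge\Phi)(X,Y,Z)=\bar\eta(X)\Phi(Y,Z)+\bar\eta(Y)\Phi(Z,X)+\bar\eta(Z)\Phi(X,Y)$. Define the tensors $$\mathcal N^{(1)}(X,Y)=f^2[X,Y]+[fX,fY]-f[fX,Y]-f[X,fY]+2\sum_i d\eta^i(X,Y)\,\xi_i,$$ $$\begin{aligned}\mathcal N^{(5)}(X,Y,Z)={}&X\big(g(fY,\widetilde QZ)\big)+fZ\big(g(X,\widetilde QY)\big)-fY\big(g(X,\widetilde QZ)\big)+g([X,fZ],\widetilde QY)-g([X,fY],\widetilde QZ)\\&+g\big([Y,fZ]-[Z,fY]-f[Y,Z],\,\widetilde QX\big).\end{aligned}$$ Let $\beta$ be a nonzero smooth function on $M$, and let $\nabla$ be the Levi-Civita connection of $g$. The manifold is called a weak $\beta$-Kenmotsu $f$-manifold if $\mathcal N^{(1)}=0$ and $(\nabla_Xf)Y=\beta\{g(fX,Y)\,\bar\xi-\bar\eta(Y)\,fX\}$ for all vector fields $X,Y$. **Theorem.** $M^{2n+s}(f,Q,\xi_i,\eta^i,g)$ is a weak $\beta$-Kenmotsu $f$-manifold if and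 only if, for all vector fields $X,Y,Z$ and all $i$, $$\mathcal N^{(1)}=0,\qquad d\eta^i=0,\qquad d\Phi=2\beta\,\bar\eta\wedge\Phi,\qquad \mathcal N^{(5)}(X,Y,Z)=2\beta\,\bar\eta(X)\,g(fY,\widetilde QZ).$$ -/

import Mathlib

open Bundle VectorField
open scoped Manifold ContDiff

noncomputable section

namespace WeakKenmotsu

section General

variable {E : Type*} [NormedAddCommGroup E] [NormedSpace ℝ E] [FiniteDimensional ℝ E]
  {H : Type*} [TopologicalSpace H] {I : ModelWithCorners ℝ E H}
  {M : Type*} [TopologicalSpace M] [ChartedSpace H M] [IsManifold I ∞ M]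

/-- Smooth vector fields on `M`. -/
def SmoothVectorField (X : Π x : M, TangentSpace I x) : Prop :=
  ContMDiff I (I.prod 𝓘(ℝ, E)) ∞ (fun x ↦ TotalSpace.mk' E x (X x))

/-- Smooth `(1,1)`-tensor fields on `M`. -/
def SmoothEndField (S : Π x : M, TangentSpace I x →L[ℝ] TangentSpace I x) : Prop :=
  ContMDiff I (I.prod 𝓘(ℝ, E →L[ℝ] E)) ∞ (fun x ↦ TotalSpace.mk' (E →L[ℝ] E) x (S x))

/-- Smooth `1`-forms on `M`. -/
def SmoothOneForm (α : Π x : M, TangentSpace I x →L[ℝ] ℝ) : Prop :=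
  ContMDiff I (I.prod 𝓘(ℝ, E →L[ℝ] ℝ)) ∞ (fun x ↦ TotalSpace.mk' (E →L[ℝ] ℝ) x (α x))

/-- The derivative `X(h)` of the function `h` along the vector field `X`. -/
def dirDeriv (X : Π x : M, TangentSpace I x) (h : M → ℝ) (x : M) : ℝ :=
  mvfderiv I h x (X x)

/-- The vector field `S X`, for a `(1,1)`-tensor field `S`. -/
def app (S : Π x : M, TangentSpace I x →L[ℝ] TangentSpace I x)
    (X : Π x : M, TangentSpace I x) : Π x : M, TangentSpace I x :=
  fun x ↦ S x (X x)

/-- The Nijenhuis torsion `[S,S](X,Y) = S²[X,Y] + [SX,SY] - S[SX,Y] - S[X,SY]`. -/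
def nijenhuis (S : Π x : M, TangentSpace I x →L[ℝ] TangentSpace I x)
    (X Y : Π x : M, TangentSpace I x) (x : M) : TangentSpace I x :=
  S x (S x (mlieBracket I X Y x)) + mlieBracket I (app S X) (app S Y) x
    - S x (mlieBracket I (app S X) Y x) - S x (mlieBracket I X (app S Y) x)

/-- The exterior derivative of a `1`-form, normalized by
`2 dα(X,Y) = X(α(Y)) - Y(α(X)) - α([X,Y])`. -/
def dOneForm (α : Π x : M, TangentSpace I x →L[ℝ] ℝ)
    (X Y : Π x : M, TangentSpace I x) (x : M) : ℝ :=
  (1 / 2 : ℝ) * (dirDeriv X (fun y ↦ α y (Y y)) x - dirDeriv Y (fun y ↦ α y (X y)) x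
    - α x (mlieBracket I X Y x))

/-- The exterior derivative of a `2`-form, normalized by
`3 dΦ(X,Y,Z) = XΦ(Y,Z) + YΦ(Z,X) + ZΦ(X,Y) - Φ([X,Y],Z) - Φ([Z,X],Y) - Φ([Y,Z],X)`. -/
def dTwoForm (Φ : Π x : M, TangentSpace I x → TangentSpace I x → ℝ)
    (X Y Z : Π x : M, TangentSpace I x) (x : M) : ℝ :=
  (1 / 3 : ℝ) * (dirDeriv X (fun y ↦ Φ y (Y y) (Z y)) x + dirDeriv Y (fun y ↦ Φ y (Z y) (X y)) x
    + dirDeriv Z (fun y ↦ Φ y (X y) (Y y)) x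
    - Φ x (mlieBracket I X Y x) (Z x) - Φ x (mlieBracket I Z X x) (Y x)
    - Φ x (mlieBracket I Y Z x) (X x))

/-- The wedge product of a `1`-form with a `2`-form at a point, normalized by
`3 (α ∧ Φ)(u,v,w) = α(u)Φ(v,w) + α(v)Φ(w,u) + α(w)Φ(u,v)`. -/
def wedgeOneTwo {x : M} (α : TangentSpace I x →L[ℝ] ℝ)
    (Φ : TangentSpace I x → TangentSpace I x → ℝ) (u v w : TangentSpace I x) : ℝ :=
  (1 / 3 : ℝ) * (α u * Φ v w + α v * Φ w u + α w * Φ u v)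

/-- `cov` is the Levi-Civita connection of `g`: it is torsion-free and
`X(g(Y,Z)) = g(∇_X Y, Z) + g(Y, ∇_X Z)`. As in Mathlib, `cov Y x (X x)` is `∇_X Y` at `x`. -/
def IsLeviCivita (g : ContMDiffRiemannianMetric I ∞ E (fun x : M ↦ TangentSpace I x))
    (cov : CovariantDerivative I E (fun x : M ↦ TangentSpace I x)) : Prop :=
  cov.torsion = 0 ∧
  ∀ X Y Z : Π x : M, TangentSpace I x,
    SmoothVectorField X → SmoothVectorField Y → SmoothVectorField Z →
    ∀ x, dirDeriv X (fun y ↦ g.inner y (Y y) (Z y)) x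
      = g.inner x (cov Y x (X x)) (Z x) + g.inner x (Y x) (cov Z x (X x))

end General

/-- A weak metric `f`-structure `(f, Q, ξ_i, η^i, g)` on the smooth manifold `M` of
dimension `2n + s`, with `f`-invariant contact distribution `⋂ ker η^i`. -/
structure WeakMetricFStructure (n s : ℕ) (M : Type*) [TopologicalSpace M]
    [ChartedSpace (EuclideanSpace ℝ (Fin (2 * n + s))) M] [IsManifold (𝓡 (2 * n + s)) ∞ M] where
  f : Π x : M, TangentSpace (𝓡 (2 * n + s)) x →L[ℝ] TangentSpace (𝓡 (2 * n + s)) x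
  Q : Π x : M, TangentSpace (𝓡 (2 * n + s)) x →L[ℝ] TangentSpace (𝓡 (2 * n + s)) x
  ξ : Fin s → Π x : M, TangentSpace (𝓡 (2 * n + s)) x
  η : Fin s → Π x : M, TangentSpace (𝓡 (2 * n + s)) x →L[ℝ] ℝ
  g : ContMDiffRiemannianMetric (𝓡 (2 * n + s)) ∞ (EuclideanSpace ℝ (Fin (2 * n + s)))
    (fun x : M ↦ TangentSpace (𝓡 (2 * n + s)) x)
  smooth_f : SmoothEndField f
  smooth_Q : SmoothEndField Q
  smooth_ξ : ∀ i, SmoothVectorField (ξ i)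
  smooth_η : ∀ i, SmoothOneForm (η i)
  rank_f : ∀ x, Module.finrank ℝ (LinearMap.range (f x).toLinearMap) = 2 * n
  nonsingular_Q : ∀ x, Function.Bijective (Q x)
  f_cube : ∀ x v, f x (f x (f x v)) + f x (Q x v) = 0
  f_sq : ∀ x v, f x (f x v) = -Q x v + ∑ i, η i x v • ξ i x
  η_ξ : ∀ x i j, η i x (ξ j x) = if i = j then 1 else 0
  Q_ξ : ∀ x i, Q x (ξ i x) = ξ i x
  contact_invariant : ∀ x v, (∀ i, η i x v = 0) → ∀ i, η i x (f x v) = 0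
  compatible : ∀ x u v,
    g.inner x (f x u) (f x v) = g.inner x u (Q x v) - ∑ i, η i x u * η i x v

namespace WeakMetricFStructure

variable {n s : ℕ} {M : Type*} [TopologicalSpace M]
  [ChartedSpace (EuclideanSpace ℝ (Fin (2 * n + s))) M] [IsManifold (𝓡 (2 * n + s)) ∞ M]
  (S : WeakMetricFStructure n s M)

/-- `Q̃ = Q - id`. -/
def Qtilde (x : M) : TangentSpace (𝓡 (2 * n + s)) x →L[ℝ] TangentSpace (𝓡 (2 * n + s)) x :=
  S.Q x - ContinuousLinearMap.id ℝ (TangentSpace (𝓡 (2 * n + s)) x)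

/-- `ξ̄ = ∑ ξ_i`. -/
def xiBar (x : M) : TangentSpace (𝓡 (2 * n + s)) x := ∑ i, S.ξ i x

/-- `η̄ = ∑ η^i`. -/
def etaBar (x : M) : TangentSpace (𝓡 (2 * n + s)) x →L[ℝ] ℝ := ∑ i, S.η i x

/-- The fundamental `2`-form `Φ(u,v) = g(u, f v)`. -/
def Phi (x : M) (u v : TangentSpace (𝓡 (2 * n + s)) x) : ℝ := S.g.inner x u (S.f x v)

/-- The normality tensor `N⁽¹⁾(X,Y) = [f,f](X,Y) + 2 ∑ dη^i(X,Y) ξ_i`. -/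
def N1 (X Y : Π x : M, TangentSpace (𝓡 (2 * n + s)) x) (x : M) :
    TangentSpace (𝓡 (2 * n + s)) x :=
  nijenhuis S.f X Y x + ∑ i, (2 * dOneForm (S.η i) X Y x) • S.ξ i x

/-- The tensor `N⁽⁵⁾(X,Y,Z) = X(g(fY,Q̃Z)) + fZ(g(X,Q̃Y)) - fY(g(X,Q̃Z)) + g([X,fZ],Q̃Y)
- g([X,fY],Q̃Z) + g([Y,fZ] - [Z,fY] - f[Y,Z], Q̃X)`. The first term is what makes the expression
`C^∞(M)`-linear in `Y` and `Z`. -/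
def N5 (X Y Z : Π x : M, TangentSpace (𝓡 (2 * n + s)) x) (x : M) : ℝ :=
  dirDeriv X (fun y ↦ S.g.inner y (S.f y (Y y)) (S.Qtilde y (Z y))) x
    + dirDeriv (app S.f Z) (fun y ↦ S.g.inner y (X y) (S.Qtilde y (Y y))) x
    - dirDeriv (app S.f Y) (fun y ↦ S.g.inner y (X y) (S.Qtilde y (Z y))) x
    + S.g.inner x (mlieBracket (𝓡 (2 * n + s)) X (app S.f Z) x) (S.Qtilde x (Y x))
    - S.g.inner x (mlieBracket (𝓡 (2 * n + s)) X (app S.f Y) x) (S.Qtilde x (Z x))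
    + S.g.inner x (mlieBracket (𝓡 (2 * n + s)) Y (app S.f Z) x
        - mlieBracket (𝓡 (2 * n + s)) Z (app S.f Y) x
        - S.f x (mlieBracket (𝓡 (2 * n + s)) Y Z x)) (S.Qtilde x (X x))

/-- The structure is normal: `N⁽¹⁾ = 0`. -/
def IsNormal : Prop :=
  ∀ X Y : Π x : M, TangentSpace (𝓡 (2 * n + s)) x,
    SmoothVectorField X → SmoothVectorField Y → ∀ x, S.N1 X Y x = 0

/-- The structure is a weak `β`-Kenmotsu `f`-structure: `β` is a nonzero smooth function, the
structure is normal, and the Levi-Civita connection satisfies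
`(∇_X f) Y = β {g(fX,Y) ξ̄ - η̄(Y) fX}`, where `(∇_X f) Y = ∇_X (fY) - f (∇_X Y)`. -/
def IsWeakBetaKenmotsu (β : M → ℝ) : Prop :=
  ContMDiff (𝓡 (2 * n + s)) 𝓘(ℝ) ∞ β ∧ β ≠ 0 ∧ S.IsNormal ∧
  ∃ cov : CovariantDerivative (𝓡 (2 * n + s)) (EuclideanSpace ℝ (Fin (2 * n + s)))
      (fun x : M ↦ TangentSpace (𝓡 (2 * n + s)) x),
    IsLeviCivita S.g cov ∧
    ∀ X Y : Π x : M, TangentSpace (𝓡 (2 * n + s)) x,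
      SmoothVectorField X → SmoothVectorField Y → ∀ x,
        cov (app S.f Y) x (X x) - S.f x (cov Y x (X x))
          = β x • (S.g.inner x (S.f x (X x)) (Y x) • S.xiBar x
              - S.etaBar x (Y x) • S.f x (X x))

end WeakMetricFStructure

end WeakKenmotsu

end

open WeakKenmotsu

noncomputable section

namespace WeakKenmotsu

section General

variable {E : Type*} [NormedAddCommGroup E] [NormedSpace ℝ E]
  {H : Type*} [TopologicalSpace H] {I : ModelWithCorners ℝ E H}
  {M : Type*} [TopologicalSpace M] [ChartedSpace H M] [IsManifold I ∞ M]

/-! ### Smooth fields -/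

lemma SmoothVectorField.mdiffAt {X : Π x : M, TangentSpace I x} (hX : SmoothVectorField X)
    (x : M) : MDiffAt (T% X) x :=
  (ContMDiff.contMDiffAt hX).mdifferentiableAt (by simp)

lemma SmoothEndField.app {S : Π x : M, TangentSpace I x →L[ℝ] TangentSpace I x}
    {X : Π x : M, TangentSpace I x} (hS : SmoothEndField S) (hX : SmoothVectorField X) :
    SmoothVectorField (app S X) :=
  ContMDiff.clm_bundle_apply (b := fun x : M ↦ x) hS hX

lemma SmoothOneForm.apply {α : Π x : M, TangentSpace I x →L[ℝ] ℝ}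
    {X : Π x : M, TangentSpace I x} (hα : SmoothOneForm α) (hX : SmoothVectorField X) :
    ContMDiff I 𝓘(ℝ) ∞ (fun x ↦ α x (X x)) := by
  have h := ContMDiff.clm_bundle_apply (F₁ := E) (F₂ := ℝ) (E₂ := Bundle.Trivial M ℝ)
    (b := fun x : M ↦ x) hα hX
  intro x
  have := h x
  simp only [contMDiffAt_totalSpace] at this
  exact this.2

lemma SmoothVectorField.add {X Y : Π x : M, TangentSpace I x} (hX : SmoothVectorField X)
    (hY : SmoothVectorField Y) : SmoothVectorField (X + Y) :=
  ContMDiff.add_section hX hY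

lemma SmoothVectorField.smul {X : Π x : M, TangentSpace I x} {f : M → ℝ}
    (hf : ContMDiff I 𝓘(ℝ) ∞ f) (hX : SmoothVectorField X) : SmoothVectorField (f • X) :=
  ContMDiff.smul_section hf hX

variable [FiniteDimensional ℝ E] in
/-- Every tangent vector extends to a global smooth vector field. -/
lemma exists_smoothVectorField_apply_eq [T2Space M] (x : M) (v : TangentSpace I x) :
    ∃ X : Π x : M, TangentSpace I x, SmoothVectorField X ∧ X x = v := by
  obtain ⟨s, hs, hsm⟩ := FiberBundle.exists_contMDiffOn_extend (k := ∞) I E v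
  obtain ⟨u, hus, hu, hxu⟩ := mem_nhds_iff.mp hs
  obtain ⟨ψ, -, hψ⟩ := (SmoothBumpFunction.nhds_basis_tsupport (I := I) x).mem_iff.mp
    (hu.mem_nhds hxu)
  refine ⟨(ψ : M → ℝ) • FiberBundle.extend E v, ?_, ?_⟩
  · exact ContMDiffOn.smul_section_of_tsupport ψ.contMDiff.contMDiffOn hu hψ (hsm.mono hus)
  · simp

/-! ### The Levi-Civita connection -/

variable (g : ContMDiffRiemannianMetric I ∞ E (fun x : M ↦ TangentSpace I x))

lemma mdiffAt_inner {X Y : Π x : M, TangentSpace I x} {x : M}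
    (hX : MDiffAt (T% X) x) (hY : MDiffAt (T% Y) x) :
    MDiffAt (fun y ↦ g.inner y (X y) (Y y)) x := by
  have hg := (g.contMDiff.contMDiffAt (x := x)).mdifferentiableAt (by simp)
  have := MDifferentiableAt.clm_bundle_apply₂ (F₁ := E) (F₂ := E) (F₃ := ℝ)
    (E₃ := Bundle.Trivial M ℝ) (b := fun x : M ↦ x) hg hX hY
  simp only [mdifferentiableAt_totalSpace] at this
  exact this.2

lemma inner_left_cancel {x : M} {u v : TangentSpace I x}
    (h : ∀ w, g.inner x u w = g.inner x v w) : u = v := by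
  by_contra hne
  have := g.pos x (u - v) (sub_ne_zero.mpr hne)
  simp [h] at this

variable [FiniteDimensional ℝ E]

/-- The Koszul expression, equal to `2 g(∇_X Y, Z)` for the Levi-Civita connection. -/
def koszul (X Y Z : Π x : M, TangentSpace I x) (x : M) : ℝ :=
  dirDeriv X (fun y ↦ g.inner y (Y y) (Z y)) x + dirDeriv Y (fun y ↦ g.inner y (Z y) (X y)) x
    - dirDeriv Z (fun y ↦ g.inner y (X y) (Y y)) x
    + g.inner x (mlieBracket I X Y x) (Z x) - g.inner x (mlieBracket I Y Z x) (X x)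
    - g.inner x (mlieBracket I X Z x) (Y x)

lemma koszul_tensorial_left {Y Z : Π x : M, TangentSpace I x} {x : M}
    (hY : MDiffAt (T% Y) x) (hZ : MDiffAt (T% Z) x) :
    TensorialAt I E (fun X ↦ koszul g X Y Z x) x where
  smul {f X} hf hX := by
    have h1 : (fun y ↦ g.inner y (Z y) ((f • X) y)) = f * fun y ↦ g.inner y (Z y) (X y) := by
      ext y; simp
    have h2 : (fun y ↦ g.inner y ((f • X) y) (Y y)) = f * fun y ↦ g.inner y (X y) (Y y) := by
      ext y; simp
    simp only [koszul, dirDeriv, h1, h2, mvfderiv_mul hf (mdiffAt_inner g hZ hX),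
      mvfderiv_mul hf (mdiffAt_inner g hX hY), mlieBracket_smul_left hf hX]
    simp [g.symm x (Z x) (X x)]
    ring
  add {X X'} hX hX' := by
    have h1 : (fun y ↦ g.inner y (Z y) ((X + X') y))
        = (fun y ↦ g.inner y (Z y) (X y)) + fun y ↦ g.inner y (Z y) (X' y) := by
      ext y; simp
    have h2 : (fun y ↦ g.inner y ((X + X') y) (Y y))
        = (fun y ↦ g.inner y (X y) (Y y)) + fun y ↦ g.inner y (X' y) (Y y) := by
      ext y; simp
    simp only [koszul, dirDeriv, h1, h2, mvfderiv_add (mdiffAt_inner g hZ hX)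
      (mdiffAt_inner g hZ hX'), mvfderiv_add (mdiffAt_inner g hX hY) (mdiffAt_inner g hX' hY),
      mlieBracket_add_left hX hX']
    simp
    ring

lemma koszul_tensorial_right {X Y : Π x : M, TangentSpace I x} {x : M}
    (hX : MDiffAt (T% X) x) (hY : MDiffAt (T% Y) x) :
    TensorialAt I E (fun Z ↦ koszul g X Y Z x) x where
  smul {f Z} hf hZ := by
    have h1 : (fun y ↦ g.inner y ((f • Z) y) (X y)) = f * fun y ↦ g.inner y (Z y) (X y) := by
      ext y; simp
    have h2 : (fun y ↦ g.inner y (Y y) ((f • Z) y)) = f * fun y ↦ g.inner y (Y y) (Z y) := by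
      ext y; simp
    simp only [koszul, dirDeriv, h1, h2, mvfderiv_mul hf (mdiffAt_inner g hZ hX),
      mvfderiv_mul hf (mdiffAt_inner g hY hZ), mlieBracket_smul_right hf hZ]
    simp [g.symm x (Y x) (Z x)]
    ring
  add {Z Z'} hZ hZ' := by
    have h1 : (fun y ↦ g.inner y ((Z + Z') y) (X y))
        = (fun y ↦ g.inner y (Z y) (X y)) + fun y ↦ g.inner y (Z' y) (X y) := by
      ext y; simp
    have h2 : (fun y ↦ g.inner y (Y y) ((Z + Z') y))
        = (fun y ↦ g.inner y (Y y) (Z y)) + fun y ↦ g.inner y (Y y) (Z' y) := by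
      ext y; simp
    simp only [koszul, dirDeriv, h1, h2, mvfderiv_add (mdiffAt_inner g hZ hX)
      (mdiffAt_inner g hZ' hX), mvfderiv_add (mdiffAt_inner g hY hZ) (mdiffAt_inner g hY hZ'),
      mlieBracket_add_right hZ hZ']
    simp
    ring

lemma koszul_add {X Y Y' Z : Π x : M, TangentSpace I x} {x : M} (hX : MDiffAt (T% X) x)
    (hY : MDiffAt (T% Y) x) (hY' : MDiffAt (T% Y') x) (hZ : MDiffAt (T% Z) x) :
    koszul g X (Y + Y') Z x = koszul g X Y Z x + koszul g X Y' Z x := by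
  have h1 : (fun y ↦ g.inner y ((Y + Y') y) (Z y))
      = (fun y ↦ g.inner y (Y y) (Z y)) + fun y ↦ g.inner y (Y' y) (Z y) := by
    ext y; simp
  have h2 : (fun y ↦ g.inner y (X y) ((Y + Y') y))
      = (fun y ↦ g.inner y (X y) (Y y)) + fun y ↦ g.inner y (X y) (Y' y) := by
    ext y; simp
  simp only [koszul, dirDeriv, h1, h2, mvfderiv_add (mdiffAt_inner g hY hZ)
    (mdiffAt_inner g hY' hZ), mvfderiv_add (mdiffAt_inner g hX hY) (mdiffAt_inner g hX hY'),
    mlieBracket_add_left hY hY', mlieBracket_add_right hY hY']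
  simp
  ring

lemma koszul_smul {X Y Z : Π x : M, TangentSpace I x} {f : M → ℝ} {x : M} (hf : MDiffAt f x)
    (hX : MDiffAt (T% X) x) (hY : MDiffAt (T% Y) x) (hZ : MDiffAt (T% Z) x) :
    koszul g X (f • Y) Z x
      = f x * koszul g X Y Z x + 2 * (mvfderiv I f x (X x) * g.inner x (Y x) (Z x)) := by
  have h1 : (fun y ↦ g.inner y ((f • Y) y) (Z y)) = f * fun y ↦ g.inner y (Y y) (Z y) := by
    ext y; simp
  have h2 : (fun y ↦ g.inner y (X y) ((f • Y) y)) = f * fun y ↦ g.inner y (X y) (Y y) := by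
    ext y; simp
  simp only [koszul, dirDeriv, h1, h2, mvfderiv_mul hf (mdiffAt_inner g hY hZ),
    mvfderiv_mul hf (mdiffAt_inner g hX hY), mlieBracket_smul_left hf hY,
    mlieBracket_smul_right hf hY]
  simp [g.symm x (X x) (Y x)]
  ring

/-- The musical isomorphism `TₓM ≃ Tₓ*M` of a Riemannian metric. -/
def flat (x : M) : TangentSpace I x ≃ₗ[ℝ] (TangentSpace I x →L[ℝ] ℝ) :=
  haveI : FiniteDimensional ℝ (TangentSpace I x) := inferInstanceAs (FiniteDimensional ℝ E)
  haveI : T2Space (TangentSpace I x) := inferInstanceAs (T2Space E)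
  LinearEquiv.ofInjectiveOfFinrankEq (g.inner x).toLinearMap
    (fun _ _ h ↦ inner_left_cancel g fun w ↦ congrArg (fun φ ↦ φ w) h)
    (Subspace.dual_finrank_eq.symm.trans LinearMap.toContinuousLinearMap.finrank_eq)

lemma inner_flat_symm (x : M) (φ : TangentSpace I x →L[ℝ] ℝ) (w : TangentSpace I x) :
    g.inner x ((flat g x).symm φ) w = φ w := by
  have h : flat g x ((flat g x).symm φ) = φ := (flat g x).apply_symm_apply φ
  exact congrArg (fun φ ↦ φ w) h

open Classical in
/-- The Levi-Civita derivative `∇Y`, with value `0` where `Y` is not differentiable. -/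
def leviCivitaAux (Y : Π x : M, TangentSpace I x) (x : M) :
    TangentSpace I x →L[ℝ] TangentSpace I x :=
  haveI : FiniteDimensional ℝ (TangentSpace I x) := inferInstanceAs (FiniteDimensional ℝ E)
  haveI : T2Space (TangentSpace I x) := inferInstanceAs (T2Space E)
  if hY : MDiffAt (T% Y) x then
    LinearMap.toContinuousLinearMap ((1 / 2 : ℝ) • (flat g x).symm.toLinearMap ∘ₗ
      (TensorialAt.mkHom₂ (I := I) (F := E) (F' := E) (fun X Z ↦ koszul g X Y Z x) x
        (fun _ hZ ↦ koszul_tensorial_left g hY hZ)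
        (fun _ hX ↦ koszul_tensorial_right g hX hY)).toLinearMap)
  else 0

lemma inner_leviCivitaAux {X Y Z : Π x : M, TangentSpace I x} {x : M} (hX : MDiffAt (T% X) x)
    (hY : MDiffAt (T% Y) x) (hZ : MDiffAt (T% Z) x) :
    g.inner x (leviCivitaAux g Y x (X x)) (Z x) = (1 / 2 : ℝ) * koszul g X Y Z x := by
  rw [leviCivitaAux, dif_pos hY]
  simp only [LinearMap.coe_toContinuousLinearMap', map_smul, smul_apply, LinearMap.comp_apply, LinearEquiv.coe_coe, inner_flat_symm,
    smul_eq_mul, ContinuousLinearMap.coe_coe]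
  rw [TensorialAt.mkHom₂_apply _ _ hX hZ]

lemma leviCivitaAux_ext {Y : Π x : M, TangentSpace I x} {x : M} (hY : MDiffAt (T% Y) x)
    {φ : TangentSpace I x →L[ℝ] TangentSpace I x}
    (h : ∀ X Z : Π x : M, TangentSpace I x, MDiffAt (T% X) x → MDiffAt (T% Z) x →
      (1 / 2 : ℝ) * koszul g X Y Z x = g.inner x (φ (X x)) (Z x)) :
    leviCivitaAux g Y x = φ := by
  ext v
  refine inner_left_cancel g fun w ↦ ?_
  have hv := FiberBundle.mdifferentiableAt_extend I E v
  have hw := FiberBundle.mdifferentiableAt_extend I E w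
  have := (inner_leviCivitaAux g hv hY hw).trans (h _ _ hv hw)
  simpa using this

/-- The Levi-Civita connection of a smooth Riemannian metric. -/
def leviCivita : CovariantDerivative I E (fun x : M ↦ TangentSpace I x) where
  toFun := leviCivitaAux g
  isCovariantDerivativeOnUniv :=
    { add := fun {Y Y' x} hY hY' _ ↦ by
        refine leviCivitaAux_ext g (mdifferentiableAt_add_section hY hY') fun X Z hX hZ ↦ ?_
        simp [koszul_add g hX hY hY' hZ, inner_leviCivitaAux g hX hY hZ,
          inner_leviCivitaAux g hX hY' hZ]
        ring
      leibniz := fun {Y f x} hY hf _ ↦ by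
        refine leviCivitaAux_ext g (hf.smul_section hY) fun X Z hX hZ ↦ ?_
        simp [koszul_smul g hf hX hY hZ, inner_leviCivitaAux g hX hY hZ]
        ring }

lemma inner_leviCivita {X Y Z : Π x : M, TangentSpace I x} {x : M} (hX : MDiffAt (T% X) x)
    (hY : MDiffAt (T% Y) x) (hZ : MDiffAt (T% Z) x) :
    g.inner x (leviCivita g Y x (X x)) (Z x) = (1 / 2 : ℝ) * koszul g X Y Z x :=
  inner_leviCivitaAux g hX hY hZ

/-- The fundamental theorem of Riemannian geometry, existence part. -/
theorem isLeviCivita_leviCivita : IsLeviCivita g (leviCivita g) := by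
  refine ⟨?_, fun X Y Z hX hY hZ x ↦ ?_⟩
  · rw [CovariantDerivative.torsion_eq_zero_iff]
    intro X Y x hX hY
    refine inner_left_cancel g fun w ↦ ?_
    have hw := FiberBundle.mdifferentiableAt_extend I E w
    have h1 := inner_leviCivita g hX hY hw
    have h2 := inner_leviCivita g hY hX hw
    simp only [koszul, FiberBundle.extend_apply_self, g.symm _ (FiberBundle.extend E w _),
      g.symm _ (Y _) (X _), mlieBracket_swap_apply (V := Y) (W := X), map_neg,
      _root_.neg_apply] at h1 h2
    simp only [map_sub, _root_.sub_apply]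
    rw [h1, h2]
    ring
  · have h1 := inner_leviCivita g (hX.mdiffAt x) (hY.mdiffAt x) (hZ.mdiffAt x)
    have h2 := inner_leviCivita g (hX.mdiffAt x) (hZ.mdiffAt x) (hY.mdiffAt x)
    simp only [koszul, g.symm _ (Z _) (Y _), g.symm _ (Y _) (X _), g.symm _ (Z _) (X _),
      mlieBracket_swap_apply (V := Z) (W := Y), map_neg, _root_.neg_apply] at h1 h2
    rw [h1, g.symm x (Y x), h2]
    ring

end General

section General

variable {E : Type*} [NormedAddCommGroup E] [NormedSpace ℝ E]
  {H : Type*} [TopologicalSpace H] {I : ModelWithCorners ℝ E H}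
  {M : Type*} [TopologicalSpace M] [ChartedSpace H M] [IsManifold I ∞ M]

/-! ### Covariant derivatives of endomorphism fields -/

lemma cov_sum (cov : CovariantDerivative I E (fun x : M ↦ TangentSpace I x)) {ι : Type*}
    (t : Finset ι) {σ : ι → Π x : M, TangentSpace I x} {x : M}
    (hσ : ∀ i, MDiffAt (T% (σ i)) x) :
    cov (fun y ↦ ∑ i ∈ t, σ i y) x = ∑ i ∈ t, cov (σ i) x := by
  classical
  induction t using Finset.induction_on with
  | empty =>
    simp only [Finset.sum_empty]
    exact congrFun cov.zero x
  | insert a t ha ih =>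
    simp only [Finset.sum_insert ha, ← ih]
    exact cov.isCovariantDerivativeOnUniv.add (hσ a) (.sum_section fun i _ ↦ hσ i)

/-- `(∇_X S) Y = ∇_X (S Y) - S (∇_X Y)` at `x`. -/
def covEnd (cov : CovariantDerivative I E (fun x : M ↦ TangentSpace I x))
    (S : Π x : M, TangentSpace I x →L[ℝ] TangentSpace I x) (X Y : Π x : M, TangentSpace I x)
    (x : M) : TangentSpace I x :=
  cov (app S Y) x (X x) - S x (cov Y x (X x))

variable [FiniteDimensional ℝ E]
  {g : ContMDiffRiemannianMetric I ∞ E (fun x : M ↦ TangentSpace I x)}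
  {cov : CovariantDerivative I E (fun x : M ↦ TangentSpace I x)}
  {S : Π x : M, TangentSpace I x →L[ℝ] TangentSpace I x} {X Y Z ζ : Π x : M, TangentSpace I x}

lemma IsLeviCivita.mlieBracket_eq (h : IsLeviCivita g cov) (hX : SmoothVectorField X)
    (hY : SmoothVectorField Y) (x : M) :
    mlieBracket I X Y x = cov Y x (X x) - cov X x (Y x) :=
  ((CovariantDerivative.torsion_eq_zero_iff cov).mp h.1 (hX.mdiffAt x) (hY.mdiffAt x)).symm

lemma IsLeviCivita.nijenhuis_eq (h : IsLeviCivita g cov) (hS : SmoothEndField S)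
    (hX : SmoothVectorField X) (hY : SmoothVectorField Y) (x : M) :
    nijenhuis S X Y x = covEnd cov S (app S X) Y x - S x (covEnd cov S X Y x)
      - (covEnd cov S (app S Y) X x - S x (covEnd cov S Y X x)) := by
  have hSX := hS.app hX
  have hSY := hS.app hY
  simp only [nijenhuis, covEnd, h.mlieBracket_eq hX hY, h.mlieBracket_eq hSX hSY,
    h.mlieBracket_eq hSX hY, h.mlieBracket_eq hX hSY, map_sub]
  abel

lemma IsLeviCivita.dOneForm_eq (h : IsLeviCivita g cov)
    {α : Π x : M, TangentSpace I x →L[ℝ] ℝ} (hα : ∀ x v, α x v = g.inner x (ζ x) v)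
    (hζ : SmoothVectorField ζ) (hX : SmoothVectorField X) (hY : SmoothVectorField Y) (x : M) :
    2 * dOneForm α X Y x = g.inner x (cov ζ x (X x)) (Y x) - g.inner x (cov ζ x (Y x)) (X x) := by
  simp only [dOneForm, hα, h.mlieBracket_eq hX hY, h.2 X ζ Y hX hζ hY, h.2 Y ζ X hY hζ hX, map_sub]
  ring

/-- The covariant derivative of a skew-symmetric endomorphism field is skew-symmetric. -/
lemma IsLeviCivita.inner_covEnd_skew (h : IsLeviCivita g cov) (hS : SmoothEndField S)
    (hskew : ∀ x u v, g.inner x (S x u) v = -g.inner x u (S x v))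
    (hX : SmoothVectorField X) (hY : SmoothVectorField Y) (hZ : SmoothVectorField Z) (x : M) :
    g.inner x (covEnd cov S X Y x) (Z x) = -g.inner x (covEnd cov S X Z x) (Y x) := by
  have h1 := h.2 X (app S Y) Z hX (hS.app hY) hZ x
  have h2 := h.2 X Y (app S Z) hX hY (hS.app hZ) x
  have h3 : (fun y ↦ g.inner y (app S Y y) (Z y)) = -fun y ↦ g.inner y (Y y) (app S Z y) := by
    ext y; exact hskew y _ _
  rw [h3] at h1
  simp only [dirDeriv, mvfderiv_neg, _root_.neg_apply] at h1 h2
  rw [h2] at h1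
  simp only [covEnd, map_sub, _root_.sub_apply, hskew, app] at h1 ⊢
  have h4 := hskew x (Y x) (cov Z x (X x))
  rw [g.symm x (cov (app S Z) x (X x)), g.symm x (cov Z x (X x)) (S x (Y x)), h4]
  linarith

/-- `3 dΦ` for `Φ(X,Y) = g(X, S Y)`, in terms of the Levi-Civita connection. -/
lemma IsLeviCivita.dTwoForm_eq (h : IsLeviCivita g cov) (hS : SmoothEndField S)
    (hskew : ∀ x u v, g.inner x (S x u) v = -g.inner x u (S x v))
    (hX : SmoothVectorField X) (hY : SmoothVectorField Y) (hZ : SmoothVectorField Z) (x : M) :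
    3 * dTwoForm (fun x u v ↦ g.inner x u (S x v)) X Y Z x
      = -(g.inner x (covEnd cov S X Y x) (Z x) + g.inner x (covEnd cov S Y Z x) (X x)
        + g.inner x (covEnd cov S Z X x) (Y x)) := by
  have h1 := h.2 X Y (app S Z) hX hY (hS.app hZ) x
  have h2 := h.2 Y Z (app S X) hY hZ (hS.app hX) x
  have h3 := h.2 Z X (app S Y) hZ hX (hS.app hY) x
  have e1 := h.inner_covEnd_skew hS hskew hX hY hZ x
  have e2 := h.inner_covEnd_skew hS hskew hY hZ hX x
  have e3 := h.inner_covEnd_skew hS hskew hZ hX hY x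
  simp only [app] at h1 h2 h3
  rw [e1, e2, e3]
  simp only [dTwoForm, h1, h2, h3, h.mlieBracket_eq hX hY, h.mlieBracket_eq hZ hX,
    h.mlieBracket_eq hY hZ, covEnd, map_sub, _root_.sub_apply, hskew]
  simp only [g.symm x (X x) (cov _ _ _), g.symm x (Y x) (cov _ _ _), g.symm x (Z x) (cov _ _ _)]
  ring

end General

namespace WeakMetricFStructure

variable {n s : ℕ} {M : Type*} [TopologicalSpace M]
  [ChartedSpace (EuclideanSpace ℝ (Fin (2 * n + s))) M] [IsManifold (𝓡 (2 * n + s)) ∞ M]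
  (S : WeakMetricFStructure n s M)

/-! ### Pointwise identities -/

lemma f_ξ (x : M) (i : Fin s) : S.f x (S.ξ i x) = 0 := by
  have h1 : S.f x (S.f x (S.ξ i x)) = 0 := by
    rw [S.f_sq, S.Q_ξ]
    simp [S.η_ξ]
  have h2 := S.f_cube x (S.ξ i x)
  rwa [h1, map_zero, zero_add, S.Q_ξ] at h2

lemma η_eq_inner (x : M) (i : Fin s) (v : TangentSpace (𝓡 (2 * n + s)) x) :
    S.η i x v = S.g.inner x (S.ξ i x) v := by
  have h := S.compatible x v (S.ξ i x)
  simp only [S.f_ξ, map_zero, S.Q_ξ, S.η_ξ, mul_ite, mul_one, mul_zero, Finset.sum_ite_eq',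
    Finset.mem_univ, if_true] at h
  rw [S.g.symm]
  linarith

lemma η_f (x : M) (i : Fin s) (v : TangentSpace (𝓡 (2 * n + s)) x) : S.η i x (S.f x v) = 0 := by
  have h := S.contact_invariant x (v - ∑ j, S.η j x v • S.ξ j x) (fun k ↦ by
    simp [map_sub, map_sum, S.η_ξ]) i
  simpa [map_sub, map_sum, S.f_ξ] using h

lemma f_Q (x : M) (v : TangentSpace (𝓡 (2 * n + s)) x) : S.f x (S.Q x v) = S.Q x (S.f x v) := by
  have h1 := congrArg (S.f x) (S.f_sq x v)
  have h2 := S.f_sq x (S.f x v)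
  rw [h2] at h1
  simpa [S.η_f, S.f_ξ, map_sum] using h1.symm

lemma inner_Q_symm (x : M) (u v : TangentSpace (𝓡 (2 * n + s)) x) :
    S.g.inner x (S.Q x u) v = S.g.inner x u (S.Q x v) := by
  have h1 := S.compatible x u v
  have h2 := S.compatible x v u
  rw [S.g.symm x (S.f x v)] at h2
  simp only [mul_comm (S.η _ x v)] at h2
  rw [S.g.symm x (S.Q x u)]
  linarith

lemma inner_f_skew (x : M) (u v : TangentSpace (𝓡 (2 * n + s)) x) :
    S.g.inner x (S.f x u) v = -S.g.inner x u (S.f x v) := by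
  obtain ⟨w, rfl⟩ := (S.nonsingular_Q x).2 v
  have h1 := S.compatible x u (S.f x w)
  simp only [S.f_sq x w, S.η_f, map_add, map_neg, map_sum, map_smul,
    S.g.symm x (S.f x u) (S.ξ _ x), ← S.η_eq_inner, smul_zero, mul_zero, Finset.sum_const_zero,
    add_zero, sub_zero, ← S.f_Q] at h1
  linarith

lemma inner_f_f (x : M) (u v : TangentSpace (𝓡 (2 * n + s)) x) :
    S.g.inner x (S.f x u) (S.f x v)
      = S.g.inner x u (S.Qtilde x v) + S.g.inner x u v - ∑ i, S.η i x u * S.η i x v := by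
  rw [S.compatible]
  simp [Qtilde]

lemma inner_Qtilde_symm (x : M) (u v : TangentSpace (𝓡 (2 * n + s)) x) :
    S.g.inner x (S.Qtilde x u) v = S.g.inner x u (S.Qtilde x v) := by
  simp [Qtilde, S.inner_Q_symm]

lemma f_Qtilde (x : M) (v : TangentSpace (𝓡 (2 * n + s)) x) :
    S.f x (S.Qtilde x v) = S.Qtilde x (S.f x v) := by
  simp [Qtilde, S.f_Q]

lemma Qtilde_eq (x : M) (v : TangentSpace (𝓡 (2 * n + s)) x) :
    S.Qtilde x v = ∑ i, S.η i x v • S.ξ i x - S.f x (S.f x v) - v := by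
  simp only [Qtilde, S.f_sq, _root_.sub_apply, ContinuousLinearMap.id_apply]
  abel

lemma inner_xiBar (x : M) (v : TangentSpace (𝓡 (2 * n + s)) x) :
    S.g.inner x (S.xiBar x) v = S.etaBar x v := by
  simp [xiBar, etaBar, S.η_eq_inner]

lemma f_xiBar (x : M) : S.f x (S.xiBar x) = 0 := by
  simp [xiBar, S.f_ξ]

lemma etaBar_f (x : M) (v : TangentSpace (𝓡 (2 * n + s)) x) : S.etaBar x (S.f x v) = 0 := by
  simp [etaBar, S.η_f]

lemma smooth_Qtilde {X : Π x : M, TangentSpace (𝓡 (2 * n + s)) x} (hX : SmoothVectorField X) :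
    SmoothVectorField (app S.Qtilde X) :=
  ContMDiff.sub_section (S.smooth_Q.app hX) hX

/-! ### The structure tensors in terms of the Levi-Civita connection -/

variable {S}
  {cov : CovariantDerivative (𝓡 (2 * n + s)) (EuclideanSpace ℝ (Fin (2 * n + s)))
    (fun x : M ↦ TangentSpace (𝓡 (2 * n + s)) x)}
  {X Y Z : Π x : M, TangentSpace (𝓡 (2 * n + s)) x}

lemma dPhi_eq (h : IsLeviCivita S.g cov) (hX : SmoothVectorField X)
    (hY : SmoothVectorField Y) (hZ : SmoothVectorField Z) (x : M) :
    3 * dTwoForm S.Phi X Y Z x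
      = -(S.g.inner x (covEnd cov S.f X Y x) (Z x) + S.g.inner x (covEnd cov S.f Y Z x) (X x)
        + S.g.inner x (covEnd cov S.f Z X x) (Y x)) :=
  h.dTwoForm_eq S.smooth_f S.inner_f_skew hX hY hZ x

/-- `N⁽⁵⁾` in terms of `∇f` and `∇Q̃`. -/
lemma N5_eq (h : IsLeviCivita S.g cov) (hX : SmoothVectorField X)
    (hY : SmoothVectorField Y) (hZ : SmoothVectorField Z) (x : M) :
    S.N5 X Y Z x = S.g.inner x (covEnd cov S.Qtilde X Z x) (S.f x (Y x))
      + S.g.inner x (covEnd cov S.f X Z x) (S.Qtilde x (Y x))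
      - S.g.inner x (covEnd cov S.Qtilde (app S.f Y) Z x) (X x)
      + S.g.inner x (covEnd cov S.Qtilde (app S.f Z) Y x) (X x)
      + S.g.inner x (covEnd cov S.f Y Z x - covEnd cov S.f Z Y x) (S.Qtilde x (X x)) := by
  have hfY := S.smooth_f.app hY
  have hfZ := S.smooth_f.app hZ
  have hTY := S.smooth_Qtilde hY
  have hTZ := S.smooth_Qtilde hZ
  have h1 := h.2 X (app S.f Y) (app S.Qtilde Z) hX hfY hTZ x
  have h2 := h.2 (app S.f Z) X (app S.Qtilde Y) hfZ hX hTY x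
  have h3 := h.2 (app S.f Y) X (app S.Qtilde Z) hfY hX hTZ x
  have e1 := S.inner_f_skew x (cov Z x (X x)) (S.Qtilde x (Y x))
  have e2 := S.inner_Qtilde_symm x (cov Z x (X x)) (S.f x (Y x))
  have e3 := S.inner_Qtilde_symm x (cov Z x (S.f x (Y x))) (X x)
  have e4 := S.inner_Qtilde_symm x (cov Y x (S.f x (Z x))) (X x)
  rw [S.f_Qtilde] at e1
  simp only [N5, h.mlieBracket_eq hX hfZ, h.mlieBracket_eq hX hfY, h.mlieBracket_eq hY hfZ,
    h.mlieBracket_eq hZ hfY, h.mlieBracket_eq hY hZ, covEnd]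
  rw [show (fun y ↦ S.g.inner y (S.f y (Y y)) (S.Qtilde y (Z y)))
      = fun y ↦ S.g.inner y (app S.f Y y) (app S.Qtilde Z y) from rfl, h1,
    show (fun y ↦ S.g.inner y (X y) (S.Qtilde y (Y y)))
      = fun y ↦ S.g.inner y (X y) (app S.Qtilde Y y) from rfl, h2,
    show (fun y ↦ S.g.inner y (X y) (S.Qtilde y (Z y)))
      = fun y ↦ S.g.inner y (X y) (app S.Qtilde Z y) from rfl, h3]
  have a (T : Π x : M, TangentSpace (𝓡 (2 * n + s)) x →L[ℝ] TangentSpace (𝓡 (2 * n + s)) x)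
    (W : Π x : M, TangentSpace (𝓡 (2 * n + s)) x) : app T W x = T x (W x) := rfl
  simp only [map_sub, _root_.sub_apply, a] at e1 e2 e3 e4 ⊢
  rw [S.g.symm x (S.f x (Y x)), S.g.symm x (X x), S.g.symm x (X x)]
  linarith

/-- `∇Q̃` is determined by `∇f` and `∇ξ`. -/
lemma covEnd_Qtilde (h : IsLeviCivita S.g cov) (hX : SmoothVectorField X)
    (hY : SmoothVectorField Y) (x : M) :
    covEnd cov S.Qtilde X Y x
      = ∑ i, (S.g.inner x (cov (S.ξ i) x (X x)) (Y x) • S.ξ i x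
          + S.η i x (Y x) • cov (S.ξ i) x (X x))
        - covEnd cov S.f X (app S.f Y) x - S.f x (covEnd cov S.f X Y x) := by
  have hfY := S.smooth_f.app hY
  have hffY := S.smooth_f.app hfY
  have hη (i) : ContMDiff (𝓡 (2 * n + s)) 𝓘(ℝ) ∞ (fun y ↦ S.η i y (Y y)) :=
    (S.smooth_η i).apply hY
  have hsum : app S.Qtilde Y + app S.f (app S.f Y) + Y
      = fun y ↦ ∑ i, ((fun y ↦ S.η i y (Y y)) • S.ξ i) y := by
    ext1 y
    simp only [Pi.add_apply, Pi.smul_apply', app, S.Qtilde_eq]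
    abel
  have hcov := congrArg (fun W ↦ cov W x (X x)) hsum
  have hTY := S.smooth_Qtilde hY
  have hL := cov.isCovariantDerivativeOnUniv
  simp only [hL.add ((hTY.add hffY).mdiffAt x) (hY.mdiffAt x),
    hL.add (hTY.mdiffAt x) (hffY.mdiffAt x),
    cov_sum cov _ fun i ↦ (SmoothVectorField.smul (hη i) (S.smooth_ξ i)).mdiffAt x,
    hL.leibniz ((S.smooth_ξ _).mdiffAt x) ((hη _ x).mdifferentiableAt (by simp)), _root_.add_apply, _root_.sum_apply,
    _root_.smul_apply, ContinuousLinearMap.smulRight_apply] at hcov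
  have hd (i) : mvfderiv (𝓡 (2 * n + s)) (fun y ↦ S.η i y (Y y)) x (X x)
      = S.g.inner x (cov (S.ξ i) x (X x)) (Y x) + S.η i x (cov Y x (X x)) := by
    have := h.2 X (S.ξ i) Y hX (S.smooth_ξ i) hY x
    simp only [S.η_eq_inner]
    exact this
  simp only [hd, add_smul, Finset.sum_add_distrib] at hcov
  simp only [covEnd, S.Qtilde_eq x (cov Y x (X x)), Finset.sum_add_distrib, map_sub]
  rw [← sub_eq_zero] at hcov ⊢
  rw [← hcov]
  abel

/-- `∑ g(∇_u ξ_i, v) η^i(w)`. -/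
def shape (S : WeakMetricFStructure n s M)
    (cov : CovariantDerivative (𝓡 (2 * n + s)) (EuclideanSpace ℝ (Fin (2 * n + s)))
      (fun x : M ↦ TangentSpace (𝓡 (2 * n + s)) x))
    (x : M) (u v w : TangentSpace (𝓡 (2 * n + s)) x) : ℝ :=
  ∑ i, S.g.inner x (cov (S.ξ i) x u) v * S.η i x w

lemma shape_f_right (x : M) (u v w : TangentSpace (𝓡 (2 * n + s)) x) :
    shape S cov x u v (S.f x w) = 0 := by
  simp [shape, S.η_f]

lemma shape_symm (h : IsLeviCivita S.g cov)
    (hη : ∀ i, ∀ X Y : Π x : M, TangentSpace (𝓡 (2 * n + s)) x,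
      SmoothVectorField X → SmoothVectorField Y → ∀ x, dOneForm (S.η i) X Y x = 0)
    (hX : SmoothVectorField X) (hY : SmoothVectorField Y) (x : M)
    (w : TangentSpace (𝓡 (2 * n + s)) x) :
    shape S cov x (X x) (Y x) w = shape S cov x (Y x) (X x) w := by
  refine Finset.sum_congr rfl fun i _ ↦ ?_
  have h1 := h.dOneForm_eq (fun x v ↦ S.η_eq_inner x i v) (S.smooth_ξ i) hX hY x
  rw [hη i X Y hX hY x, mul_zero, eq_comm, sub_eq_zero] at h1
  rw [h1]

lemma inner_covEnd_Qtilde (h : IsLeviCivita S.g cov) (hX : SmoothVectorField X)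
    (hY : SmoothVectorField Y) (x : M) (w : TangentSpace (𝓡 (2 * n + s)) x) :
    S.g.inner x (covEnd cov S.Qtilde X Y x) w
      = shape S cov x (X x) (Y x) w + shape S cov x (X x) w (Y x)
        - S.g.inner x (covEnd cov S.f X (app S.f Y) x) w
        + S.g.inner x (covEnd cov S.f X Y x) (S.f x w) := by
  rw [covEnd_Qtilde h hX hY]
  simp only [map_sub, map_sum, map_add, map_smul, _root_.sub_apply, _root_.sum_apply,
    _root_.add_apply, _root_.smul_apply, smul_eq_mul, ← S.η_eq_inner, S.inner_f_skew,
    Finset.sum_add_distrib, shape, mul_comm (S.η _ x (Y x))]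
  ring

lemma η_covEnd_f (h : IsLeviCivita S.g cov) (hX : SmoothVectorField X)
    (hY : SmoothVectorField Y) (i : Fin s) (x : M) :
    S.η i x (covEnd cov S.f X Y x) = -S.g.inner x (cov (S.ξ i) x (X x)) (S.f x (Y x)) := by
  have h1 := h.inner_covEnd_skew S.smooth_f S.inner_f_skew hX hY (S.smooth_ξ i) x
  have h2 : app S.f (S.ξ i) = 0 := by
    ext1 y; exact S.f_ξ y i
  rw [S.η_eq_inner, S.g.symm, h1]
  simp [covEnd, h2, S.inner_f_skew]

lemma sum_η_covEnd_f (h : IsLeviCivita S.g cov) (hX : SmoothVectorField X)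
    (hY : SmoothVectorField Y) (x : M) (w : TangentSpace (𝓡 (2 * n + s)) x) :
    ∑ i, S.η i x (covEnd cov S.f X Y x) * S.η i x w = -shape S cov x (X x) (S.f x (Y x)) w := by
  simp [shape, η_covEnd_f h hX hY]

/-- When the forms `η^i` are closed, `∇f` is determined by `dΦ`, the Nijenhuis torsion of `f`
and `N⁽⁵⁾`. -/
theorem two_mul_inner_covEnd_f (h : IsLeviCivita S.g cov)
    (hη : ∀ i, ∀ X Y : Π x : M, TangentSpace (𝓡 (2 * n + s)) x,
      SmoothVectorField X → SmoothVectorField Y → ∀ x, dOneForm (S.η i) X Y x = 0)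
    (hX : SmoothVectorField X) (hY : SmoothVectorField Y) (hZ : SmoothVectorField Z) (x : M) :
    2 * S.g.inner x (covEnd cov S.f X Y x) (Z x)
      = 3 * dTwoForm S.Phi X (app S.f Y) (app S.f Z) x - 3 * dTwoForm S.Phi X Y Z x
        + S.g.inner x (nijenhuis S.f Y Z x) (S.f x (X x)) + S.N5 X Y Z x := by
  have hfY := S.smooth_f.app hY
  have hfZ := S.smooth_f.app hZ
  have a (W : Π x : M, TangentSpace (𝓡 (2 * n + s)) x) : app S.f W x = S.f x (W x) := rfl
  have skew {U V W : Π x : M, TangentSpace (𝓡 (2 * n + s)) x} (hU : SmoothVectorField U)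
      (hV : SmoothVectorField V) (hW : SmoothVectorField W) :=
    h.inner_covEnd_skew S.smooth_f S.inner_f_skew hU hV hW x
  have k1 := skew hX hfY hfZ
  have k2 := skew hX hY hZ
  have k3 := skew hfZ hX hfY
  have k4 := skew hZ hX hY
  have s1 := shape_symm h hη hfY hZ x (X x)
  have s2 := shape_symm h hη hfY hX x (Z x)
  have s3 := shape_symm h hη hfZ hY x (X x)
  have s4 := shape_symm h hη hfZ hX x (Y x)
  have f2 := S.inner_f_skew x (covEnd cov S.f X Z x) (S.f x (Y x))
  simp only [S.inner_f_f, sum_η_covEnd_f h hX hZ] at f2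
  rw [dPhi_eq h hX hfY hfZ, dPhi_eq h hX hY hZ, h.nijenhuis_eq S.smooth_f hY hZ, N5_eq h hX hY hZ]
  simp only [map_sub, _root_.sub_apply, S.inner_f_f, sum_η_covEnd_f h hY hZ,
    sum_η_covEnd_f h hZ hY, inner_covEnd_Qtilde h hX hZ, inner_covEnd_Qtilde h hfY hZ,
    inner_covEnd_Qtilde h hfZ hY, shape_f_right, a] at k1 k2 k3 k4 s1 s2 s3 s4 f2 ⊢
  linarith

end WeakMetricFStructure

namespace WeakMetricFStructure

variable {n s : ℕ} {M : Type*} [TopologicalSpace M]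
  [ChartedSpace (EuclideanSpace ℝ (Fin (2 * n + s))) M] [IsManifold (𝓡 (2 * n + s)) ∞ M]
  {S : WeakMetricFStructure n s M}
  {cov : CovariantDerivative (𝓡 (2 * n + s)) (EuclideanSpace ℝ (Fin (2 * n + s)))
    (fun x : M ↦ TangentSpace (𝓡 (2 * n + s)) x)}
  {X Y Z : Π x : M, TangentSpace (𝓡 (2 * n + s)) x} {β : M → ℝ}

/-- The `β`-Kenmotsu formula `(∇_X f) Y = β {g(fX,Y) ξ̄ - η̄(Y) fX}`. -/
def HasKenmotsuDerivative (S : WeakMetricFStructure n s M) (β : M → ℝ)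
    (cov : CovariantDerivative (𝓡 (2 * n + s)) (EuclideanSpace ℝ (Fin (2 * n + s)))
      (fun x : M ↦ TangentSpace (𝓡 (2 * n + s)) x)) : Prop :=
  ∀ X Y : Π x : M, TangentSpace (𝓡 (2 * n + s)) x,
    SmoothVectorField X → SmoothVectorField Y → ∀ x,
      covEnd cov S.f X Y x = β x • (S.g.inner x (S.f x (X x)) (Y x) • S.xiBar x
        - S.etaBar x (Y x) • S.f x (X x))

/-! ### Consequences of the Kenmotsu formula -/

lemma HasKenmotsuDerivative.inner_covEnd (hK : HasKenmotsuDerivative S β cov)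
    (hX : SmoothVectorField X) (hY : SmoothVectorField Y) (x : M)
    (w : TangentSpace (𝓡 (2 * n + s)) x) :
    S.g.inner x (covEnd cov S.f X Y x) w
      = β x * (S.g.inner x (S.f x (X x)) (Y x) * S.etaBar x w
        - S.etaBar x (Y x) * S.g.inner x (S.f x (X x)) w) := by
  simp [hK X Y hX hY x, S.inner_xiBar]

lemma HasKenmotsuDerivative.nijenhuis_eq_zero (hK : HasKenmotsuDerivative S β cov)
    (h : IsLeviCivita S.g cov) (hX : SmoothVectorField X) (hY : SmoothVectorField Y) (x : M) :
    nijenhuis S.f X Y x = 0 := by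
  have hfX := S.smooth_f.app hX
  have hfY := S.smooth_f.app hY
  have e : S.g.inner x (S.f x (S.f x (X x))) (Y x) = S.g.inner x (S.f x (S.f x (Y x))) (X x) := by
    rw [S.inner_f_skew, S.inner_f_skew x (S.f x (Y x)), S.g.symm]
  rw [h.nijenhuis_eq S.smooth_f hX hY, hK _ _ hfX hY, hK _ _ hX hY, hK _ _ hfY hX, hK _ _ hY hX]
  simp only [app, map_smul, map_sub, S.f_xiBar, smul_zero, zero_sub, e]
  module

lemma dOneForm_η_eq_zero {x : M} (hN : S.N1 X Y x = 0) (hnij : nijenhuis S.f X Y x = 0)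
    (i : Fin s) : dOneForm (S.η i) X Y x = 0 := by
  rw [N1, hnij, zero_add] at hN
  have h := congrArg (S.η i x) hN
  simpa [map_sum, S.η_ξ] using h

lemma nijenhuis_eq_zero {x : M} (hN : S.N1 X Y x = 0) (hη : ∀ i, dOneForm (S.η i) X Y x = 0) :
    nijenhuis S.f X Y x = 0 := by
  simpa [N1, hη] using hN

lemma HasKenmotsuDerivative.dPhi_eq (hK : HasKenmotsuDerivative S β cov)
    (h : IsLeviCivita S.g cov) (hX : SmoothVectorField X) (hY : SmoothVectorField Y)
    (hZ : SmoothVectorField Z) (x : M) :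
    dTwoForm S.Phi X Y Z x
      = 2 * β x * wedgeOneTwo (S.etaBar x) (S.Phi x) (X x) (Y x) (Z x) := by
  have h1 := WeakMetricFStructure.dPhi_eq h hX hY hZ x
  rw [hK.inner_covEnd hX hY, hK.inner_covEnd hY hZ, hK.inner_covEnd hZ hX] at h1
  have e1 := S.inner_f_skew x (X x) (Y x)
  have e2 := S.inner_f_skew x (Y x) (Z x)
  have e3 := S.inner_f_skew x (Z x) (X x)
  rw [e1, e2, e3, S.g.symm x (S.f x (X x)), S.g.symm x (S.f x (Y x)),
    S.g.symm x (S.f x (Z x))] at h1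
  simp only [wedgeOneTwo, Phi]
  linear_combination (1 / 3) * h1

/-- When `Φ` satisfies the Kenmotsu structure equation, the contribution of `dΦ` to `∇f`. -/
lemma dPhi_app_sub_dPhi
    (hΦ : ∀ X Y Z : Π x : M, TangentSpace (𝓡 (2 * n + s)) x,
      SmoothVectorField X → SmoothVectorField Y → SmoothVectorField Z → ∀ x,
        dTwoForm S.Phi X Y Z x
          = 2 * β x * wedgeOneTwo (S.etaBar x) (S.Phi x) (X x) (Y x) (Z x))
    (hX : SmoothVectorField X) (hY : SmoothVectorField Y) (hZ : SmoothVectorField Z) (x : M) :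
    3 * dTwoForm S.Phi X (app S.f Y) (app S.f Z) x - 3 * dTwoForm S.Phi X Y Z x
      = 2 * β x * (S.g.inner x (S.f x (X x)) (Y x) * S.etaBar x (Z x)
          - S.etaBar x (Y x) * S.g.inner x (S.f x (X x)) (Z x))
        - 2 * β x * S.etaBar x (X x) * S.g.inner x (S.f x (Y x)) (S.Qtilde x (Z x)) := by
  rw [hΦ X _ _ hX (S.smooth_f.app hY) (S.smooth_f.app hZ), hΦ X Y Z hX hY hZ]
  have e1 : S.g.inner x (S.f x (Y x)) (S.f x (S.f x (Z x)))
      = -(S.g.inner x (S.f x (Y x)) (S.Qtilde x (Z x)) - S.g.inner x (Y x) (S.f x (Z x))) := by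
    have h1 := S.inner_f_f x (Y x) (S.f x (Z x))
    simp only [S.η_f, mul_zero, Finset.sum_const_zero, sub_zero, ← S.f_Qtilde] at h1
    have h2 := S.inner_f_skew x (Y x) (S.Qtilde x (Z x))
    linarith
  have e2 := S.inner_f_skew x (X x) (Y x)
  have e3 := S.g.symm x (Z x) (S.f x (X x))
  simp only [wedgeOneTwo, Phi, app, S.etaBar_f, e1, e2, e3]
  ring

/-- Under the Kenmotsu formula, the forms `η^i` of a normal structure are closed. -/
lemma HasKenmotsuDerivative.dOneForm_eq_zero (hK : HasKenmotsuDerivative S β cov)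
    (h : IsLeviCivita S.g cov) (hN : S.IsNormal) (i : Fin s)
    (hX : SmoothVectorField X) (hY : SmoothVectorField Y) (x : M) :
    dOneForm (S.η i) X Y x = 0 :=
  dOneForm_η_eq_zero (hN X Y hX hY x) (hK.nijenhuis_eq_zero h hX hY x) i

lemma HasKenmotsuDerivative.N5_eq (hK : HasKenmotsuDerivative S β cov)
    (h : IsLeviCivita S.g cov) (hN : S.IsNormal) (hX : SmoothVectorField X)
    (hY : SmoothVectorField Y) (hZ : SmoothVectorField Z) (x : M) :
    S.N5 X Y Z x
      = 2 * β x * S.etaBar x (X x) * S.g.inner x (S.f x (Y x)) (S.Qtilde x (Z x)) := by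
  have h1 := two_mul_inner_covEnd_f h
    (fun i _ _ hX hY x ↦ hK.dOneForm_eq_zero h hN i hX hY x) hX hY hZ x
  have h2 := dPhi_app_sub_dPhi (fun _ _ _ hX hY hZ x ↦ hK.dPhi_eq h hX hY hZ x) hX hY hZ x
  rw [hK.nijenhuis_eq_zero h hY hZ, hK.inner_covEnd hX hY, h2, map_zero, _root_.zero_apply] at h1
  linear_combination -h1

/-- The structure equations imply the Kenmotsu formula. -/
lemma hasKenmotsuDerivative_of_structure_equations [T2Space M] (h : IsLeviCivita S.g cov)
    (hN : S.IsNormal)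
    (hη : ∀ i, ∀ X Y : Π x : M, TangentSpace (𝓡 (2 * n + s)) x,
      SmoothVectorField X → SmoothVectorField Y → ∀ x, dOneForm (S.η i) X Y x = 0)
    (hΦ : ∀ X Y Z : Π x : M, TangentSpace (𝓡 (2 * n + s)) x,
      SmoothVectorField X → SmoothVectorField Y → SmoothVectorField Z → ∀ x,
        dTwoForm S.Phi X Y Z x
          = 2 * β x * wedgeOneTwo (S.etaBar x) (S.Phi x) (X x) (Y x) (Z x))
    (h5 : ∀ X Y Z : Π x : M, TangentSpace (𝓡 (2 * n + s)) x,
      SmoothVectorField X → SmoothVectorField Y → SmoothVectorField Z → ∀ x,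
        S.N5 X Y Z x = 2 * β x * S.etaBar x (X x)
          * S.g.inner x (S.f x (Y x)) (S.Qtilde x (Z x))) :
    HasKenmotsuDerivative S β cov := by
  intro X Y hX hY x
  refine inner_left_cancel S.g fun w ↦ ?_
  obtain ⟨Z, hZ, rfl⟩ := exists_smoothVectorField_apply_eq x w
  have h1 := two_mul_inner_covEnd_f h hη hX hY hZ x
  rw [nijenhuis_eq_zero (hN Y Z hY hZ x) (fun i ↦ hη i Y Z hY hZ x), map_zero, _root_.zero_apply,
    dPhi_app_sub_dPhi hΦ hX hY hZ, h5 X Y Z hX hY hZ] at h1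
  simp only [map_smul, map_sub, _root_.smul_apply, _root_.sub_apply, smul_eq_mul, S.inner_xiBar]
  linear_combination (1 / 2) * h1

end WeakMetricFStructure

end WeakKenmotsu

end

open WeakKenmotsu
theorem theorem2p1 {n s : ℕ} (hn : 0 < n) (hs : 1 < s)
    {M : Type*} [TopologicalSpace M] [T2Space M] [SecondCountableTopology M]
    [ChartedSpace (EuclideanSpace ℝ (Fin (2 * n + s))) M] [IsManifold (𝓡 (2 * n + s)) ∞ M]
    (S : WeakMetricFStructure n s M)
    (β : M → ℝ) (hβ : ContMDiff (𝓡 (2 * n + s)) 𝓘(ℝ) ∞ β) (hβ0 : β ≠ 0) :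
    S.IsWeakBetaKenmotsu β ↔
      (∀ X Y : Π x : M, TangentSpace (𝓡 (2 * n + s)) x,
        SmoothVectorField X → SmoothVectorField Y → ∀ x, S.N1 X Y x = 0) ∧
      (∀ i, ∀ X Y : Π x : M, TangentSpace (𝓡 (2 * n + s)) x,
        SmoothVectorField X → SmoothVectorField Y → ∀ x, dOneForm (S.η i) X Y x = 0) ∧
      (∀ X Y Z : Π x : M, TangentSpace (𝓡 (2 * n + s)) x,
        SmoothVectorField X → SmoothVectorField Y → SmoothVectorField Z → ∀ x,
          dTwoForm S.Phi X Y Z x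
            = 2 * β x * wedgeOneTwo (S.etaBar x) (S.Phi x) (X x) (Y x) (Z x)) ∧
      (∀ X Y Z : Π x : M, TangentSpace (𝓡 (2 * n + s)) x,
        SmoothVectorField X → SmoothVectorField Y → SmoothVectorField Z → ∀ x,
          S.N5 X Y Z x
            = 2 * β x * S.etaBar x (X x)
                * S.g.inner x (S.f x (Y x)) (S.Qtilde x (Z x))) := by
  constructor
  · rintro ⟨-, -, hN, cov, h, hcov⟩
    have hK : S.HasKenmotsuDerivative β cov := hcov
    exact ⟨hN, fun i _ _ hX hY x ↦ hK.dOneForm_eq_zero h hN i hX hY x,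
      fun _ _ _ hX hY hZ x ↦ hK.dPhi_eq h hX hY hZ x,
      fun _ _ _ hX hY hZ x ↦ hK.N5_eq h hN hX hY hZ x⟩
  · rintro ⟨hN, hη, hΦ, h5⟩
    have h := isLeviCivita_leviCivita S.g
    exact ⟨hβ, hβ0, hN, leviCivita S.g, h,
      WeakMetricFStructure.hasKenmotsuDerivative_of_structure_equations h hN hη hΦ h5⟩
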